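/- Fix a countable signature; structures are nonempty first-order structures of this signature. Let $\mathcal C$ be a Fraïssé class, i.e. a nonempty class of finitely generated structures, with countably many isomorphism types, closed under isomorphism and finitely generated substructures, and having the joint embedding and amalgamation properties. Let $\overline{\mathcal C}$ be the class of all countable structures all of whose finitely generated substructures belong to $\mathcal C$, regarded as a category with all homomorphisms as morphisms. A structure $C$ is a one-point extension of its substructure $B$ if $C$ is generated by $B\cup\{x\}$ for some $x\in C\setminus B$. Assume: (i) (strict amalgamation property) for all embeddings $f:B\to A$, $g:B\to C$ with $A,B,C\in\mathcal C$ there are $P\in\mathcal C$ and embeddings $i_1:A\to P$, $i_2:C\to P$ such that $i_1f=i_2g$ is a pushout square in $\overline{\mathcal C}$; (ii) (strict one-point homomorphism extension property) for all $B,B',C\in\mathcal C$, every surjective homomorphism $f:B\to B'$ and every embedding $i:B\to C$ making $C$ a one-point extension of $i(B)$, the span $C\xleftarrow{\,i\,}B\xrightarrow{\,f\,}B'$ has a pushout in $\overline{\mathcal C}$ which belongs to $\mathcal C$, and in every pushout square $f'i=i'f$ in $\overline{\mathcal C}$, where $f':C\to P$ and $i':B'\to P$, the map $i'$ is an embedding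 and $f'$ is surjective; (iii) whenever $B,C\in\mathcal C$ and $C$ is a one-point extension of $B$, the only automorphism of $C$ fixing $B$ pointwise is the identity. For $A\in\overline{\mathcal C}$ let $(B_i,C_i)_{i\in I}$ be a list of all pairs consisting of a finitely generated substructure $B_i$ of $A$ and a one-point extension $C_i\in\mathcal C$ of $B_i$, in which every such pair is represented exactly once up to isomorphism (where $(B,C)$ and $(B,C')$ are isomorphic if there is an isomorphism $C\to C'$ that is the identity on $B$). Let $A^\star$ denote the free $\mathcal C$-sum of $A$ and the $C_i$ over the $B_i$, that is, a structure $A^\star\in\overline{\mathcal C}$ with embeddings $f:A\to A^\star$ and $g_i:C_i\to A^\star$ such that $f|_{B_i}=g_i|_{B_i}$ for all $i\in I$, and such that for every $D\in\overline{\mathcal C}$ and all homomorphisms $\varphi:A\to D$, $\psi_i:C_i\to D$ with $\varphi|_{B_i}=\psi_i|_{B_i}$ for all $i\in I$ there is a unique homomorphism $\delta:A^\star\to D$ with $\delta f=\varphi$ and $\delta g_i=\psi_i$ for all $i\in I$. Then for every $A\in\overline{\mathcal C}$ the structure $A^\star$ exists and the monoid $\operatorname{End}(A)$ embeds into the monoid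 $\operatorname{End}(A^\star)$. Consequently, if $F$ is the Fraïssé limit of $\mathcal C$, then $\operatorname{End}(A)$ embeds into $\operatorname{End}(F)$. -/

import Mathlib

/-!
Conventions. First-order structures are nonempty. Mathlib's `IsFraisse` classes contain, when the
signature has no constant symbols, also the empty structure; hence every property below that refers
to members of a class refers to the nonempty ones. Nothing else changes: amalgamation over the
empty structure is joint embedding.
-/

universe u v w

namespace FraisseEnd

open FirstOrder FirstOrder.Language CategoryTheory

variable {L : FirstOrder.Language.{u, v}}

/-- The endomorphism monoid of a structure, with `(φ * ψ) x = φ (ψ x)`. -/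
instance endMonoid (A : Type w) [L.Structure A] : Monoid (A →[L] A) where
  one := Hom.id L A
  mul φ ψ := φ.comp ψ
  one_mul φ := Hom.id_comp φ
  mul_one φ := Hom.comp_id φ
  mul_assoc φ ψ χ := Hom.comp_assoc χ ψ φ

/-- `End A` embeds (as a monoid) into `End D`. -/
def EndEmbeds (L : FirstOrder.Language.{u, v}) (A D : Type w) [L.Structure A] [L.Structure D] : Prop :=
  ∃ Φ : (A →[L] A) →* (D →[L] D), Function.Injective Φ

/-- The class of all countable structures all of whose finitely generated substructures
belong to `K`. -/
def closureClass (K : Set (Bundled.{w} L.Structure)) : Set (Bundled.{w} L.Structure) :=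
  {A | Nonempty A ∧ Countable A ∧ ∀ S : L.Substructure A, S.FG → (⟨S, inferInstance⟩ : Bundled.{w} L.Structure) ∈ K}

/-- The square
```
  Y --i₁--> P
  ^         ^
  f         i₂
  |         |
  X --g---> Z
```
is a pushout square in the category whose objects are the structures in the class `T` and whose
morphisms are all homomorphisms between them. -/
structure IsPushoutSquare (T : Set (Bundled.{w} L.Structure)) {X Y Z P : Bundled.{w} L.Structure}
    (f : X →[L] Y) (g : X →[L] Z) (i₁ : Y →[L] P) (i₂ : Z →[L] P) : Prop where
  mem_X : X ∈ T
  mem_Y : Y ∈ T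
  mem_Z : Z ∈ T
  mem_P : P ∈ T
  comm : i₁.comp f = i₂.comp g
  desc : ∀ Q ∈ T, ∀ (j₁ : Y →[L] Q) (j₂ : Z →[L] Q), j₁.comp f = j₂.comp g →
    ∃! h : P →[L] Q, h.comp i₁ = j₁ ∧ h.comp i₂ = j₂

/-- The homomorphism `f` is an embedding. -/
def IsEmb {M N : Type w} [L.Structure M] [L.Structure N] (f : M →[L] N) : Prop :=
  ∃ e : M ↪[L] N, e.toHom = f

/-- Via the embedding `e`, the structure `C` is a one-point extension of `B`: it is generated by
(the image of) `B` together with one element outside `B`. -/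
def IsOnePointExt {B C : Type w} [L.Structure B] [L.Structure C] (e : B ↪[L] C) : Prop :=
  ∃ x : C, x ∉ Set.range e ∧ Substructure.closure L (Set.range e ∪ {x}) = ⊤

/-- The strict amalgamation property: every amalgam in `K` has an amalgamated free sum with
respect to `closureClass K`, the sum belongs to `K`, and the two canonical maps into it are
embeddings. -/
def StrictAP (K : Set (Bundled.{w} L.Structure)) : Prop :=
  ∀ A ∈ K, ∀ B ∈ K, ∀ C ∈ K, Nonempty B → ∀ (f : B ↪[L] A) (g : B ↪[L] C),
    ∃ P ∈ K, ∃ (i₁ : A ↪[L] P) (i₂ : C ↪[L] P),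
      IsPushoutSquare (closureClass K) f.toHom g.toHom i₁.toHom i₂.toHom

/-- The strict one-point homomorphism extension property: every span `C ← B → B'` in `K`, where
`C` is a one-point extension of `B` and `f : B → B'` is a surjective homomorphism, has a pushout
with respect to `closureClass K` that belongs to `K`, and in each pushout square of the span the
map from `B'` is an embedding and the map from `C` is surjective. -/
def StrictOnePHEP (K : Set (Bundled.{w} L.Structure)) : Prop :=
  ∀ B ∈ K, ∀ B' ∈ K, ∀ C ∈ K, Nonempty B →
    ∀ (i : B ↪[L] C) (f : B →[L] B'), IsOnePointExt i → Function.Surjective f →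
      (∃ P ∈ K, ∃ (f' : C →[L] P) (i' : B' →[L] P),
        IsPushoutSquare (closureClass K) i.toHom f f' i') ∧
      ∀ (P : Bundled.{w} L.Structure) (f' : C →[L] P) (i' : B' →[L] P),
        IsPushoutSquare (closureClass K) i.toHom f f' i' → IsEmb i' ∧ Function.Surjective f'

/-- For every one-point extension `C` of `B` in `K`, the pointwise stabilizer of `B` in `Aut C`
is trivial. -/
def TrivialStabilizers (K : Set (Bundled.{w} L.Structure)) : Prop :=
  ∀ B ∈ K, ∀ C ∈ K, Nonempty B → ∀ e : B ↪[L] C, IsOnePointExt e →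
    ∀ σ : C ≃[L] C, (∀ b, σ (e b) = e b) → σ = FirstOrder.Language.Equiv.refl L C

/-- A rooted multi-amalgam over `K` with root `A`: a countable family of finitely generated
substructures `B i` of `A`, each with an extension `C i` in `K`. The extensions are given by
embeddings `emb i : B i ↪ C i`, so that no disjointness condition on them is needed. -/
structure RootedMultiAmalgam (K : Set (Bundled.{w} L.Structure)) (A : Bundled.{w} L.Structure) where
  ι : Type
  countable_ι : Countable ι
  B : ι → L.Substructure A
  C : ι → Bundled.{w} L.Structure
  emb : ∀ i, B i ↪[L] C i
  B_nonempty : ∀ i, Nonempty (B i)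
  B_fg : ∀ i, (B i).FG
  B_mem : ∀ i, (⟨B i, inferInstance⟩ : Bundled.{w} L.Structure) ∈ K
  C_mem : ∀ i, C i ∈ K

/-- `D` is the free sum of the rooted multi-amalgam `R` over `K`. -/
def IsFreeSum {K : Set (Bundled.{w} L.Structure)} {A : Bundled.{w} L.Structure}
    (R : RootedMultiAmalgam K A) (D : Bundled.{w} L.Structure) : Prop :=
  D ∈ closureClass K ∧
  ∃ (f : A ↪[L] D) (g : ∀ i, R.C i ↪[L] D),
    (∀ i (b : R.B i), f b = g i (R.emb i b)) ∧
    ∀ D' ∈ closureClass K, ∀ (φ : A →[L] D') (ψ : ∀ i, R.C i →[L] D'),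
      (∀ i (b : R.B i), φ b = ψ i (R.emb i b)) →
      ∃! δ : D →[L] D', δ.comp f.toHom = φ ∧ ∀ i, δ.comp (g i).toHom = ψ i

/-- `R` lists all pairs `(S, E)`, where `S` is a finitely generated substructure of the root `A`
and `E` in `K` is a one-point extension of `S`; each isomorphism type of such pairs (isomorphisms
of extensions of `S` being the identity on `S`) is represented exactly once. -/
structure IsOnePointEnumeration {K : Set (Bundled.{w} L.Structure)} {A : Bundled.{w} L.Structure}
    (R : RootedMultiAmalgam K A) : Prop where
  onePoint : ∀ i, IsOnePointExt (R.emb i)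
  existsUnique : ∀ (S : L.Substructure A), Nonempty S → S.FG → ∀ E ∈ K, ∀ e : S ↪[L] E,
    IsOnePointExt e →
      ∃! i, ∃ (h : R.B i = S) (σ : R.C i ≃[L] E),
        ∀ b : R.B i, σ (R.emb i b) = e (Substructure.inclusion h.le b)

/-- `D` is (a copy of) `A⋆`: the free sum of the rooted multi-amalgam formed by `A` and all
one-point extensions in `K` of finitely generated substructures of `A`, up to isomorphism. -/
def IsStar (K : Set (Bundled.{w} L.Structure)) (A D : Bundled.{w} L.Structure) : Prop :=
  ∃ R : RootedMultiAmalgam K A, IsOnePointEnumeration R ∧ IsFreeSum R D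

end FraisseEnd

namespace FraisseEnd

open FirstOrder FirstOrder.Language CategoryTheory

variable {L : FirstOrder.Language.{u, v}}

/-! ### Members of a Fraïssé class and of its closure -/

/-! An endomorphism `φ` of `A` acts on the extensions that are adjoined to form `A⋆`. Restrict `φ`
to a surjection `B i → φ (B i)` and push `C i` out along it. By the strict one-point homomorphism
extension property the pushout `P` contains `φ (B i)` and is a quotient of `C i`, so it is generated
over `φ (B i)` by at most one point (`exists_pushout_of_isSmallExt`). Such a `P` has a standard
embedding into `A⋆`: the one inherited from `A` if nothing new was added, and otherwise the one
given by the listed copy of `P`. Since each extension is listed once and has no nontrivial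
automorphism over its base, this map is canonical (`StarCocone.IsStd.unique`). The composites `C i →
P → A⋆` agree with `φ` on the `B i`, so the universal property of `A⋆` yields an endomorphism `φ⋆`
extending `φ`.

Canonicity turns `φ ↦ φ⋆` into a monoid homomorphism: pushing out along `ψ` and then along `φ` is
pushing out along `φψ` (`IsPushoutSquare.paste`), and `φ⋆` carries every standard map, not just the
listed ones, to the canonical map of its pushout (`StarCocone.IsExtension.isPush_comp`). Injectivity
holds because `φ⋆` restricts to `φ` on `A`.

There are only countably many pairs `(B i, C i)`, so `A⋆` is the union of a chain that adjoins one
`C i` at a time. Each step amalgamates over a countable root, which is itself a chain of finitely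
generated strict amalgamations.

For the Fraïssé limit, iterate `A ↦ A⋆`. The union of `A, A⋆, A⋆⋆, …` realizes every one-point
extension in `K` of its finitely generated substructures, hence is the Fraïssé limit, and the maps
between the endomorphism monoids pass to the union. -/

theorem mem_of_equiv {K : Set (Bundled.{w} L.Structure)} (hK : IsFraisse K)
    {M N : Bundled.{w} L.Structure} (e : M ≃[L] N) (hM : M ∈ K) : N ∈ K :=
  (hK.is_equiv_invariant ⟨e⟩).1 hM

theorem countable_of_mem [Countable (Σ l, L.Functions l)] {K : Set (Bundled.{w} L.Structure)}
    (hK : IsFraisse K) {M : Bundled.{w} L.Structure} (hM : M ∈ K) : Countable M :=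
  Structure.cg_iff_countable.1 (hK.FG M hM).cg

theorem mem_closureClass_of_mem [Countable (Σ l, L.Functions l)]
    {K : Set (Bundled.{w} L.Structure)} (hK : IsFraisse K) {M : Bundled.{w} L.Structure}
    (hM : M ∈ K) [hn : Nonempty M] : M ∈ closureClass K :=
  ⟨hn, countable_of_mem hK hM, fun S hS =>
    hK.hereditary M hM ⟨(Substructure.fg_iff_structure_fg S).1 hS, ⟨S.subtype⟩⟩⟩

theorem mem_of_fg_of_embedding {K : Set (Bundled.{w} L.Structure)} (hK : IsFraisse K)
    {M N : Bundled.{w} L.Structure} (hN : N ∈ closureClass K) (hM : Structure.FG L M)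
    (e : M ↪[L] N) : M ∈ K :=
  mem_of_equiv (M := ⟨e.toHom.range, inferInstance⟩) hK e.equivRange.symm
    (hN.2.2 _ (hM.range e.toHom))

/-! ### Colimits of chains of embeddings -/

/-- The cocone `ι` exhibits `D` as the union of the chain `G`. -/
structure IsChainLimit {G : ℕ → Type w} [∀ n, L.Structure (G n)] (u : ∀ n, G n ↪[L] G (n + 1))
    {D : Type w} [L.Structure D] (ι : ∀ n, G n ↪[L] D) : Prop where
  map_succ : ∀ n x, ι (n + 1) (u n x) = ι n x
  exists_rep : ∀ d, ∃ n x, ι n x = d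

theorem exists_isChainLimit (G : ℕ → Type w) [∀ n, L.Structure (G n)]
    (u : ∀ n, G n ↪[L] G (n + 1)) :
    ∃ (D : Bundled.{w} L.Structure) (ι : ∀ n, G n ↪[L] D), IsChainLimit u ι := by
  let f : ∀ i j, i ≤ j → G i ↪[L] G j := DirectedSystem.natLERec u
  refine ⟨Bundled.of (@DirectLimit L _ _ G _ f _ _), fun n => DirectLimit.of L ℕ G f n, ?_, ?_⟩
  · intro n x
    have h : f n (n + 1) n.le_succ x = u n x := by
      have := DirectedSystem.coe_natLERec (f' := u) n (n + 1) n.le_succ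
      have h2 := congrFun this x
      refine h2.trans ?_
      rw [Nat.leRecOn_succ' ]
    rw [← h]
    exact DirectLimit.of_f
  · intro d
    exact DirectLimit.exists_of d

namespace IsChainLimit

variable {G : ℕ → Type w} [∀ n, L.Structure (G n)] {u : ∀ n, G n ↪[L] G (n + 1)}
  {D : Type w} [L.Structure D] {ι : ∀ n, G n ↪[L] D}

theorem exists_rep_of_le (h : IsChainLimit u ι) {m n : ℕ} (hmn : m ≤ n) (x : G m) :
    ∃ y, ι n y = ι m x := by
  induction n, hmn using Nat.le_induction with
  | base => exact ⟨x, rfl⟩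
  | succ k _ ih =>
    obtain ⟨y, hy⟩ := ih
    exact ⟨u k y, (h.map_succ k y).trans hy⟩

theorem exists_rep_finite (h : IsChainLimit u ι) {α : Type*} [Finite α] (x : α → D) :
    ∃ (n : ℕ) (y : α → G n), ∀ a, ι n (y a) = x a := by
  choose n y hy using fun a => h.exists_rep (x a)
  obtain ⟨N, hN⟩ := Finite.bddAbove_range n
  choose z hz using fun a => h.exists_rep_of_le (hN ⟨a, rfl⟩) (y a)
  exact ⟨N, z, fun a => (hz a).trans (hy a)⟩

/-- Finitely many generators already appear together at one stage of the chain. -/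
theorem exists_map_eq_of_fg (h : IsChainLimit u ι) {S : L.Substructure D} (hS : S.FG) :
    ∃ (n : ℕ) (T : L.Substructure (G n)), T.FG ∧ T.map (ι n).toHom = S := by
  obtain ⟨t, ht⟩ := hS
  obtain ⟨n, y, hy⟩ := h.exists_rep_finite (fun a : t => (a : D))
  refine ⟨n, Substructure.closure L (Set.range y), Substructure.fg_closure (Set.finite_range y), ?_⟩
  rw [Substructure.map_closure, ← ht]
  congr 1
  ext d
  constructor
  · rintro ⟨_, ⟨a, rfl⟩, rfl⟩
    have : (ι n).toHom (y a) = a := hy a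
    rw [this]
    exact a.2
  · intro hd
    exact ⟨y ⟨d, hd⟩, ⟨_, rfl⟩, hy ⟨d, hd⟩⟩

theorem countable (h : IsChainLimit u ι) (hG : ∀ n, Countable (G n)) : Countable D := by
  have : Function.Surjective (fun p : Σ n, G n => ι p.1 p.2) := fun d =>
    let ⟨n, x, hx⟩ := h.exists_rep d
    ⟨⟨n, x⟩, hx⟩
  exact this.countable

theorem hom_ext (h : IsChainLimit u ι) {Q : Type*} [L.Structure Q] {f g : D →[L] Q}
    (hfg : ∀ n x, f (ι n x) = g (ι n x)) : f = g := by
  ext d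
  obtain ⟨n, x, rfl⟩ := h.exists_rep d
  exact hfg n x

/-- Makes the map out of the union in `exists_lift` independent of the chosen representatives. -/
theorem map_eq_of_le (h : IsChainLimit u ι) {Q : Type*} [L.Structure Q] {g : ∀ n, G n →[L] Q}
    (hg : ∀ n x, g (n + 1) (u n x) = g n x) {m n : ℕ} (hmn : m ≤ n) {x : G m} {y : G n}
    (hxy : ι n y = ι m x) : g n y = g m x := by
  have key : ∃ y, ι n y = ι m x ∧ g n y = g m x := by
    clear hxy y
    induction n, hmn using Nat.le_induction with
    | base => exact ⟨x, rfl, rfl⟩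
    | succ k _ ih =>
      obtain ⟨y, hy, hy'⟩ := ih
      exact ⟨u k y, (h.map_succ k y).trans hy, (hg k y).trans hy'⟩
  obtain ⟨y', h1, h2⟩ := key
  rw [← h2, (ι n).injective (hxy.trans h1.symm)]

theorem map_eq (h : IsChainLimit u ι) {Q : Type*} [L.Structure Q] {g : ∀ n, G n →[L] Q}
    (hg : ∀ n x, g (n + 1) (u n x) = g n x) {m n : ℕ} {x : G m} {y : G n}
    (hxy : ι n y = ι m x) : g n y = g m x := by
  rcases le_total m n with hmn | hmn
  · exact h.map_eq_of_le hg hmn hxy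
  · exact (h.map_eq_of_le hg hmn hxy.symm).symm

/-- Homomorphisms out of the members of a chain induce one out of the union. -/
theorem exists_lift (h : IsChainLimit u ι) {Q : Type*} [L.Structure Q] (g : ∀ n, G n →[L] Q)
    (hg : ∀ n x, g (n + 1) (u n x) = g n x) :
    ∃ k : D →[L] Q, ∀ n x, k (ι n x) = g n x := by
  choose N X hX using h.exists_rep
  have key : ∀ n x, g (N (ι n x)) (X (ι n x)) = g n x := fun n x => h.map_eq hg (hX _)
  refine ⟨⟨fun d => g (N d) (X d), ?_, ?_⟩, key⟩
  · intro k F x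
    obtain ⟨n, y, hy⟩ := h.exists_rep_finite x
    obtain rfl : (fun a => ι n (y a)) = x := funext hy
    have e : Structure.funMap F (fun a => ι n (y a)) = ι n (Structure.funMap F y) :=
      ((ι n).map_fun F y).symm
    rw [e, key, (g n).map_fun]
    congr 1
    funext a
    exact (key n (y a)).symm
  · intro k r x hr
    obtain ⟨n, y, hy⟩ := h.exists_rep_finite x
    obtain rfl : (fun a => ι n (y a)) = x := funext hy
    have e : Structure.RelMap r y := ((ι n).map_rel r y).1 hr
    have e' := (g n).map_rel r y e
    convert! e' using 1
    funext a
    exact key n (y a)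

theorem exists_lift_embedding (h : IsChainLimit u ι) {Q : Type*} [L.Structure Q]
    (g : ∀ n, G n ↪[L] Q) (hg : ∀ n x, g (n + 1) (u n x) = g n x) :
    ∃ k : D ↪[L] Q, ∀ n x, k (ι n x) = g n x := by
  obtain ⟨k, hk⟩ := h.exists_lift (fun n => (g n).toHom) hg
  refine ⟨⟨⟨k, ?_⟩, fun F x => k.map_fun F x, fun {l} r x => ⟨fun hr => ?_, k.map_rel r x⟩⟩, hk⟩
  · intro a b hab
    obtain ⟨n, y, hy⟩ := h.exists_rep_finite ![a, b]
    have ha : ι n (y 0) = a := hy 0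
    have hb : ι n (y 1) = b := hy 1
    rw [← ha, ← hb, hk, hk] at hab
    rw [← ha, ← hb, (g n).injective hab]
  · obtain ⟨n, y, hy⟩ := h.exists_rep_finite x
    obtain rfl : (fun a => ι n (y a)) = x := funext hy
    refine ((ι n).map_rel r y).2 (((g n).map_rel r y).1 ?_)
    convert! hr using 1
    funext a
    exact (hk n (y a)).symm

/-- Extending a homomorphism step by step along a chain. -/
theorem exists_lift_of_step (h : IsChainLimit u ι) {Q : Type*} [L.Structure Q]
    (P T : ∀ n, (G n →[L] Q) → Prop) (g₀ : G 0 →[L] Q) (h₀ : P 0 g₀)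
    (step : ∀ n g, P n g → ∃ g' : G (n + 1) →[L] Q,
      g'.comp (u n).toHom = g ∧ P (n + 1) g' ∧ T (n + 1) g') :
    ∃ k : D →[L] Q, k.comp (ι 0).toHom = g₀ ∧ ∀ n, P n (k.comp (ι n).toHom) ∧
      T (n + 1) (k.comp (ι (n + 1)).toHom) := by
  choose s hs using fun n (g : {g // P n g}) => step n g.1 g.2
  let g : ∀ n, {g // P n g} := fun n =>
    Nat.rec (motive := fun n => {g // P n g}) ⟨g₀, h₀⟩ (fun n g => ⟨s n g, (hs n g).2.1⟩) n
  obtain ⟨k, hk⟩ := h.exists_lift (fun n => (g n).1)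
    (fun n x => DFunLike.congr_fun (hs n (g n)).1 x)
  have hk' : ∀ n, k.comp (ι n).toHom = (g n).1 := fun n => Hom.ext (hk n)
  refine ⟨k, hk' 0, fun n => ?_⟩
  rw [hk', hk']
  exact ⟨(g n).2, (hs n (g n)).2.2⟩

end IsChainLimit

theorem IsChainLimit.mem_closureClass {K : Set (Bundled.{w} L.Structure)} (hK : IsFraisse K)
    {G : ℕ → Bundled.{w} L.Structure} {u : ∀ n, G n ↪[L] G (n + 1)}
    {D : Bundled.{w} L.Structure} {ι : ∀ n, G n ↪[L] D}
    (h : IsChainLimit (G := fun n => G n) u ι) (hG : ∀ n, G n ∈ closureClass K) :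
    D ∈ closureClass K := by
  refine ⟨(hG 0).1.map (ι 0), h.countable fun n => (hG n).2.1, fun S hS => ?_⟩
  obtain ⟨n, T, hT, rfl⟩ := h.exists_map_eq_of_fg hS
  refine mem_of_equiv (M := ⟨T, inferInstance⟩) hK ?_ ((hG n).2.2 T hT)
  exact (ι n).substructureEquivMap T

/-! ### Pushout squares -/

/-- Mutually inverse homomorphisms form an isomorphism. -/
def equivOfInverse {M N : Type*} [L.Structure M] [L.Structure N] (f : M →[L] N) (g : N →[L] M)
    (hgf : g.comp f = Hom.id L M) (hfg : f.comp g = Hom.id L N) : M ≃[L] N where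
  toFun := f
  invFun := g
  left_inv := DFunLike.congr_fun hgf
  right_inv := DFunLike.congr_fun hfg
  map_fun' := f.map_fun
  map_rel' {n} r x := by
    refine ⟨fun h => ?_, f.map_rel r x⟩
    have := g.map_rel r _ h
    convert! this using 1
    funext a
    exact (DFunLike.congr_fun hgf (x a)).symm

namespace IsPushoutSquare

variable {T : Set (Bundled.{w} L.Structure)} {X Y Z P Z' P' : Bundled.{w} L.Structure}

/-- Source of multiplicativity: the extension pushed forward along `p` and then along `q` is the one
pushed forward along `q.comp p`. -/
theorem paste {i : X →[L] Y} {p : X →[L] Z} {f' : Y →[L] P} {i' : Z →[L] P}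
    {q : Z →[L] Z'} {f'' : P →[L] P'} {i'' : Z' →[L] P'}
    (h₁ : IsPushoutSquare T i p f' i') (h₂ : IsPushoutSquare T i' q f'' i'') :
    IsPushoutSquare T i (q.comp p) (f''.comp f') i'' where
  mem_X := h₁.mem_X
  mem_Y := h₁.mem_Y
  mem_Z := h₂.mem_Z
  mem_P := h₂.mem_P
  comm := by
    rw [Hom.comp_assoc, h₁.comm, ← Hom.comp_assoc, h₂.comm, Hom.comp_assoc]
  desc Q hQ j₁ j₂ hj := by
    obtain ⟨k, ⟨hk₁, hk₂⟩, hk⟩ := h₁.desc Q hQ j₁ (j₂.comp q) (by rw [hj, Hom.comp_assoc])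
    obtain ⟨m, ⟨hm₁, hm₂⟩, hm⟩ := h₂.desc Q hQ k j₂ hk₂
    refine ⟨m, ⟨by rw [← Hom.comp_assoc, hm₁, hk₁], hm₂⟩, ?_⟩
    rintro m' ⟨h1, h2⟩
    refine hm m' ⟨hk _ ⟨by rw [Hom.comp_assoc, h1], ?_⟩, h2⟩
    rw [Hom.comp_assoc, h₂.comm, ← Hom.comp_assoc, h2]

/-- The isomorphism respects both legs, so standard maps out of two pushouts of the same span can be
compared. -/
theorem exists_equiv {i : X →[L] Y} {p : X →[L] Z} {f₁ : Y →[L] P} {i₁ : Z →[L] P}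
    {f₂ : Y →[L] P'} {i₂ : Z →[L] P'} (h₁ : IsPushoutSquare T i p f₁ i₁)
    (h₂ : IsPushoutSquare T i p f₂ i₂) :
    ∃ τ : P ≃[L] P', (∀ y, τ (f₁ y) = f₂ y) ∧ ∀ z, τ (i₁ z) = i₂ z := by
  obtain ⟨s, ⟨hs₁, hs₂⟩, -⟩ := h₁.desc P' h₂.mem_P f₂ i₂ h₂.comm
  obtain ⟨t, ⟨ht₁, ht₂⟩, -⟩ := h₂.desc P h₁.mem_P f₁ i₁ h₁.comm
  refine ⟨equivOfInverse s t ?_ ?_, DFunLike.congr_fun hs₁, DFunLike.congr_fun hs₂⟩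
  · refine (h₁.desc P h₁.mem_P f₁ i₁ h₁.comm).unique ⟨?_, ?_⟩ ⟨Hom.id_comp _, Hom.id_comp _⟩
    · rw [Hom.comp_assoc, hs₁, ht₁]
    · rw [Hom.comp_assoc, hs₂, ht₂]
  · refine (h₂.desc P' h₂.mem_P f₂ i₂ h₂.comm).unique ⟨?_, ?_⟩ ⟨Hom.id_comp _, Hom.id_comp _⟩
    · rw [Hom.comp_assoc, ht₁, hs₁]
    · rw [Hom.comp_assoc, ht₂, hs₂]

/-- The pushout of an isomorphism. -/
theorem of_equiv (hX : X ∈ T) (hY : Y ∈ T) (hZ : Z ∈ T) (e : X ≃[L] Y) (p : X →[L] Z) :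
    IsPushoutSquare T e.toHom p (p.comp e.symm.toHom) (Hom.id L Z) where
  mem_X := hX
  mem_Y := hY
  mem_Z := hZ
  mem_P := hZ
  comm := by
    ext x
    change p (e.symm (e x)) = p x
    rw [e.symm_apply_apply]
  desc Q hQ j₁ j₂ hj := by
    refine ⟨j₂, ⟨?_, Hom.comp_id _⟩, fun k hk => by rw [← hk.2, Hom.comp_id]⟩
    ext y
    have := DFunLike.congr_fun hj (e.symm y)
    change j₁ (e (e.symm y)) = j₂ (p (e.symm y)) at this
    rw [e.apply_symm_apply] at this
    exact this.symm

/-- The pushout along an identity. -/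
theorem of_id (hX : X ∈ T) (hY : Y ∈ T) (i : X →[L] Y) :
    IsPushoutSquare T i (Hom.id L X) (Hom.id L Y) i where
  mem_X := hX
  mem_Y := hY
  mem_Z := hX
  mem_P := hY
  comm := by rw [Hom.comp_id, Hom.id_comp]
  desc Q hQ j₁ j₂ hj := ⟨j₁, ⟨Hom.comp_id _, by rw [hj, Hom.comp_id]⟩,
    fun k hk => by rw [← hk.1, Hom.comp_id]⟩

end IsPushoutSquare

/-! ### Amalgamated free sums over countable structures -/

/-- Strict amalgamation, where one of the two extensions may be countably generated. -/
theorem exists_isPushoutSquare_of_mem_closureClass [Countable (Σ l, L.Functions l)]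
    {K : Set (Bundled.{w} L.Structure)} (hK : IsFraisse K) (h_ap : StrictAP K)
    {A B C : Bundled.{w} L.Structure} (hA : A ∈ closureClass K) (hB : B ∈ K) (hC : C ∈ K)
    (hn : Nonempty B) (e : B ↪[L] A) (c : B ↪[L] C) :
    ∃ D ∈ closureClass K, ∃ (i₁ : A ↪[L] D) (i₂ : C ↪[L] D),
      IsPushoutSquare (closureClass K) e.toHom c.toHom i₁.toHom i₂.toHom := by
  have := hA.1
  have := hA.2.1
  obtain ⟨a, ha⟩ := exists_surjective_nat A
  let S : ℕ → L.Substructure A := fun n => Nat.rec (motive := fun _ => L.Substructure A)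
    e.toHom.range (fun n s => s ⊔ Substructure.closure L {a n}) n
  have hS : ∀ n, (S n).FG := by
    intro n
    induction n with
    | zero => exact (hK.FG B hB).range e.toHom
    | succ n ih => exact ih.sup (Substructure.fg_closure_singleton _)
  have hle : ∀ n, S n ≤ S (n + 1) := fun n => le_sup_left
  have hne : ∀ n, Nonempty (S n) := by
    intro n
    induction n with
    | zero => exact hn.map e.equivRange
    | succ n ih => exact ih.map (Substructure.inclusion (hle n))
  have hSA : IsChainLimit (G := fun n => S n) (fun n => Substructure.inclusion (hle n))
      (fun n => (S n).subtype) := by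
    refine ⟨fun _ _ => rfl, fun d => ?_⟩
    obtain ⟨n, rfl⟩ := ha d
    exact ⟨n + 1, ⟨a n, (le_sup_right : _ ≤ S n ⊔ Substructure.closure L {a n})
      (Substructure.subset_closure rfl)⟩, rfl⟩
  -- A stage is a member of `K` containing a copy of `S n`. Amalgamating it strictly with `S (n +
  -- 1)` over `S n` gives the next stage, and these pushouts stack up to a pushout over all of `A`.
  let St : ℕ → Type _ := fun n => Σ P : {P : Bundled.{w} L.Structure // P ∈ K}, S n ↪[L] P.1
  have step : ∀ n (s : St n), ∃ (s' : St (n + 1)) (t : s.1.1 ↪[L] s'.1.1),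
      IsPushoutSquare (closureClass K) (X := ⟨S n, inferInstance⟩) (Y := ⟨S (n + 1), inferInstance⟩)
        (Substructure.inclusion (hle n)).toHom s.2.toHom s'.2.toHom t.toHom := by
    intro n s
    obtain ⟨P, hP, i₁, i₂, h⟩ := h_ap ⟨S (n + 1), inferInstance⟩ (hA.2.2 _ (hS (n + 1)))
      ⟨S n, inferInstance⟩ (hA.2.2 _ (hS n)) s.1.1 s.1.2 (hne n)
      (Substructure.inclusion (hle n)) s.2
    exact ⟨⟨⟨P, hP⟩, i₁⟩, i₂, h⟩
  choose next t ht using step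
  let s : ∀ n, St n := fun n => Nat.rec (motive := St)
    ⟨⟨C, hC⟩, c.comp e.equivRange.symm.toEmbedding⟩ next n
  let u : ∀ n, (s n).1.1 ↪[L] (s (n + 1)).1.1 := fun n => t n (s n)
  have hu : ∀ n, IsPushoutSquare (closureClass K) (X := ⟨S n, inferInstance⟩)
      (Y := ⟨S (n + 1), inferInstance⟩) (Substructure.inclusion (hle n)).toHom (s n).2.toHom
      (s (n + 1)).2.toHom (u n).toHom := fun n => ht n (s n)
  obtain ⟨D, ι, hD⟩ := exists_isChainLimit (fun n => (s n).1.1) u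
  have hcl : ∀ n, (s n).1.1 ∈ closureClass K := fun n => (hu n).mem_Z
  have hDK : D ∈ closureClass K := hD.mem_closureClass hK hcl
  obtain ⟨i₁, hi₁⟩ := hSA.exists_lift_embedding (fun n => (ι n).comp (s n).2) (fun n x => by
    have h1 : (s (n + 1)).2 (Substructure.inclusion (hle n) x) = u n ((s n).2 x) :=
      DFunLike.congr_fun (hu n).comm x
    change ι (n + 1) ((s (n + 1)).2 (Substructure.inclusion (hle n) x)) = ι n ((s n).2 x)
    rw [h1]
    exact hD.map_succ n _)
  have hi₁' : ∀ n (x : S n), i₁ x = ι n ((s n).2 x) := hi₁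
  have hBcl : B ∈ closureClass K := mem_closureClass_of_mem hK hB
  have hcomm : ∀ b, i₁ (e b) = ι 0 (c b) := by
    intro b
    refine (hi₁' 0 (e.equivRange b)).trans ?_
    change ι 0 (c (e.equivRange.symm (e.equivRange b))) = _
    rw [Language.Equiv.symm_apply_apply]
  refine ⟨D, hDK, i₁, ι 0, hBcl, hA, hcl 0, hDK, Hom.ext hcomm, fun Q hQ j₁ j₂ hj => ?_⟩
  refine existsUnique_of_exists_of_unique ?_ ?_
  · obtain ⟨k, hk₀, hk⟩ := hD.exists_lift_of_step
      (fun n g => g.comp (s n).2.toHom = j₁.comp (S n).subtype.toHom) (fun _ _ => True) j₂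
      (by
        ext x
        obtain ⟨b, rfl⟩ := e.equivRange.surjective x
        change j₂ (c (e.equivRange.symm (e.equivRange b))) = j₁ (e b)
        rw [Language.Equiv.symm_apply_apply]
        exact (DFunLike.congr_fun hj b).symm)
      (fun n g hg => by
        obtain ⟨k, ⟨hk₁, hk₂⟩, -⟩ := (hu n).desc Q hQ (j₁.comp (S (n + 1)).subtype.toHom) g hg.symm
        exact ⟨k, hk₂, hk₁, trivial⟩)
    refine ⟨k, hSA.hom_ext fun n x => ?_, hk₀⟩
    refine Eq.trans ?_ (DFunLike.congr_fun (hk n).1 x)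
    exact congrArg k (hi₁' n x)
  · rintro k k' ⟨hk₁, hk₂⟩ ⟨hk'₁, hk'₂⟩
    -- Both maps are prescribed on `C`, which is stage 0, and uniqueness in the `n`-th pushout
    -- carries agreement from stage `n` to stage `n + 1`.
    have key : ∀ n, k.comp (ι n).toHom = k'.comp (ι n).toHom := by
      intro n
      induction n with
      | zero => exact hk₂.trans hk'₂.symm
      | succ n ih =>
        have hstep : ∀ m : D →[L] Q, (m.comp (ι (n + 1)).toHom).comp (u n).toHom =
            m.comp (ι n).toHom := fun m => Hom.ext fun x => congrArg m (hD.map_succ n x)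
        have hres : ∀ m : D →[L] Q, m.comp i₁.toHom = j₁ →
            (m.comp (ι (n + 1)).toHom).comp (s (n + 1)).2.toHom =
              j₁.comp (S (n + 1)).subtype.toHom := by
          rintro m rfl
          exact Hom.ext fun x => congrArg m (hi₁' (n + 1) x).symm
        refine ((hu n).desc Q hQ (j₁.comp (S (n + 1)).subtype.toHom) (k.comp (ι n).toHom) ?_).unique
          ⟨hres k hk₁, hstep k⟩ ⟨hres k' hk'₁, (hstep k').trans ih.symm⟩
        rw [← hk₁]
        exact Hom.ext fun x => congrArg k (hi₁' n x)
    exact hD.hom_ext fun n x => DFunLike.congr_fun (key n) x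

/-! ### Free sums of countable rooted multi-amalgams -/

/-- The extensions are adjoined one at a time in the order of an injection `enc` into `ℕ`; a step
whose number is not a code changes nothing. The family indexed by `enc i = n` has at most one member
and treats both cases uniformly. -/
theorem exists_isFreeSum [Countable (Σ l, L.Functions l)]
    {K : Set (Bundled.{w} L.Structure)} (hK : IsFraisse K) (h_ap : StrictAP K)
    {A : Bundled.{w} L.Structure} (hA : A ∈ closureClass K) (R : RootedMultiAmalgam K A) :
    ∃ D, IsFreeSum R D := by
  have := R.countable_ι
  obtain ⟨enc, henc⟩ := exists_injective_nat R.ι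
  let St : Type _ := Σ X : {X : Bundled.{w} L.Structure // X ∈ closureClass K}, A ↪[L] X.1
  have step : ∀ (n : ℕ) (s : St), ∃ (s' : St) (t : s.1.1 ↪[L] s'.1.1)
      (g : ∀ i, enc i = n → (R.C i ↪[L] s'.1.1)), (∀ a, t (s.2 a) = s'.2 a) ∧
      (∀ i h (b : R.B i), s'.2 b = g i h (R.emb i b)) ∧
      ∀ Q ∈ closureClass K, ∀ (ψ : ∀ i, R.C i →[L] Q) (δ : s.1.1 →[L] Q),
        (∀ i (b : R.B i), δ (s.2 b) = ψ i (R.emb i b)) →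
        ∃! δ' : s'.1.1 →[L] Q, δ'.comp t.toHom = δ ∧ ∀ i h, δ'.comp (g i h).toHom = ψ i := by
    rintro n ⟨⟨X, hX⟩, e⟩
    by_cases hn : ∃ i, enc i = n
    · obtain ⟨i, rfl⟩ := hn
      obtain ⟨D, hD, i₁, i₂, hp⟩ := exists_isPushoutSquare_of_mem_closureClass hK h_ap hX
        (R.B_mem i) (R.C_mem i) (R.B_nonempty i) (e.comp (R.B i).subtype) (R.emb i)
      refine ⟨⟨⟨D, hD⟩, i₁.comp e⟩, i₁, fun j h => by cases henc h; exact i₂, fun _ => rfl, ?_, ?_⟩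
      · intro j h b
        cases henc h
        exact DFunLike.congr_fun hp.comm b
      · intro Q hQ ψ δ hδ
        obtain ⟨k, ⟨hk₁, hk₂⟩, hk⟩ := hp.desc Q hQ δ (ψ i) (Hom.ext (hδ i))
        refine ⟨k, ⟨hk₁, ?_⟩, fun k' hk' => hk k' ⟨hk'.1, hk'.2 i rfl⟩⟩
        intro j h
        cases henc h
        exact hk₂
    · push Not at hn
      exact ⟨⟨⟨X, hX⟩, e⟩, Embedding.refl L X, fun i h => (hn i h).elim, fun _ => rfl,
        fun i h => (hn i h).elim, fun Q hQ ψ δ hδ => ⟨δ, ⟨rfl, fun i h => (hn i h).elim⟩,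
          fun δ' hδ' => hδ'.1⟩⟩
  choose next t g ht hg hdesc using step
  let s : ℕ → St := fun n => Nat.rec (motive := fun _ => St) ⟨⟨A, hA⟩, Embedding.refl L A⟩ next n
  let u : ∀ n, (s n).1.1 ↪[L] (s (n + 1)).1.1 := fun n => t n (s n)
  obtain ⟨D, ι, hD⟩ := exists_isChainLimit (fun n => (s n).1.1) u
  have hDK : D ∈ closureClass K := hD.mem_closureClass hK fun n => (s n).1.2
  have hf : ∀ n a, ι n ((s n).2 a) = ι 0 a := by
    intro n a
    induction n with
    | zero => rfl
    | succ n ih => rw [← ih, ← hD.map_succ n]; exact congrArg _ (ht n (s n) a).symm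
  let f : A ↪[L] D := ι 0
  let γ : ∀ i, R.C i ↪[L] D := fun i => (ι (enc i + 1)).comp (g (enc i) (s (enc i)) i rfl)
  refine ⟨D, hDK, f, γ, ?_, ?_⟩
  · intro i b
    refine (hf (enc i + 1) b).symm.trans ?_
    exact congrArg (ι (enc i + 1)) (hg (enc i) (s (enc i)) i rfl b)
  · intro Q hQ φ ψ hφ
    refine existsUnique_of_exists_of_unique ?_ ?_
    · obtain ⟨k, hk₀, hk⟩ := hD.exists_lift_of_step
        (fun n δ => δ.comp (s n).2.toHom = φ)
        -- `C i` enters between stages `enc i` and `enc i + 1`, so the condition concerns successor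
        -- stages only and is vacuous at stage 0.
        (fun n δ => ∀ m (h : n = m + 1) i (h' : enc i = m),
          (δ.comp (by subst h; exact (g m (s m) i h').toHom) : R.C i →[L] Q) = ψ i) φ rfl
        (fun n δ hδ => by
          obtain ⟨δ', ⟨h₁, h₂⟩, -⟩ := hdesc n (s n) Q hQ ψ δ
            (fun i b => (DFunLike.congr_fun hδ (b : A)).trans (hφ i b))
          refine ⟨δ', h₁, ?_, ?_⟩
          · rw [← hδ, ← h₁]
            exact Hom.ext fun a => congrArg δ' (ht n (s n) a).symm
          · intro m h i h'
            cases h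
            exact h₂ i h')
      exact ⟨k, hk₀, fun i => (hk (enc i)).2 (enc i) rfl i rfl⟩
    · rintro k k' ⟨hk₁, hk₂⟩ ⟨hk'₁, hk'₂⟩
      have key : ∀ n, k.comp (ι n).toHom = k'.comp (ι n).toHom := by
        intro n
        induction n with
        | zero => exact hk₁.trans hk'₁.symm
        | succ n ih =>
          have hstep : ∀ m : D →[L] Q, (m.comp (ι (n + 1)).toHom).comp (u n).toHom =
              m.comp (ι n).toHom := fun m => Hom.ext fun x => congrArg m (hD.map_succ n x)
          refine (hdesc n (s n) Q hQ ψ (k.comp (ι n).toHom) ?_).unique ⟨hstep k, ?_⟩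
            ⟨(hstep k').trans ih.symm, ?_⟩
          · intro i b
            refine Eq.trans (congrArg k (hf n b)) ?_
            exact (DFunLike.congr_fun hk₁ (b : A)).trans (hφ i b)
          · rintro i rfl
            exact hk₂ i
          · rintro i rfl
            exact hk'₂ i
      exact hD.hom_ext fun n x => DFunLike.congr_fun (key n) x

/-! ### Enumerations of the one-point extensions -/

/-- Isomorphism of extensions of substructures of `A`. -/
def ExtIso {A : Type w} [L.Structure A] {S S' : L.Substructure A} {E E' : Type w} [L.Structure E]
    [L.Structure E'] (e : S ↪[L] E) (e' : S' ↪[L] E') : Prop :=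
  ∃ (h : S = S') (σ : E ≃[L] E'), ∀ b : S, σ (e b) = e' (Substructure.inclusion h.le b)

namespace ExtIso

variable {A : Type w} [L.Structure A] {S S' S'' : L.Substructure A} {E E' E'' : Type w}
  [L.Structure E] [L.Structure E'] [L.Structure E''] {e : S ↪[L] E} {e' : S' ↪[L] E'}
  {e'' : S'' ↪[L] E''}

theorem refl (e : S ↪[L] E) : ExtIso e e := ⟨rfl, Language.Equiv.refl L E, fun _ => rfl⟩

theorem symm (h : ExtIso e e') : ExtIso e' e := by
  obtain ⟨rfl, σ, hσ⟩ := h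
  refine ⟨rfl, σ.symm, fun b => ?_⟩
  refine (congrArg σ.symm (hσ b).symm).trans (σ.symm_apply_apply _)

theorem trans (h : ExtIso e e') (h' : ExtIso e' e'') : ExtIso e e'' := by
  obtain ⟨rfl, σ, hσ⟩ := h
  obtain ⟨rfl, τ, hτ⟩ := h'
  exact ⟨rfl, τ.comp σ, fun b => (congrArg τ (hσ b)).trans (hτ b)⟩

end ExtIso

theorem IsOnePointExt.comp_equiv {B C D : Type w} [L.Structure B] [L.Structure C] [L.Structure D]
    {e : B ↪[L] C} (h : IsOnePointExt e) (τ : C ≃[L] D) : IsOnePointExt (τ.toEmbedding.comp e) := by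
  obtain ⟨x, hx, hx'⟩ := h
  refine ⟨τ x, ?_, ?_⟩
  · rintro ⟨b, hb⟩
    exact hx ⟨b, τ.injective hb⟩
  · have h1 : Set.range (τ.toEmbedding.comp e) ∪ {τ x} = τ.toHom '' (Set.range e ∪ {x}) := by
      rw [Set.image_union, Set.image_singleton, ← Set.range_comp]
      rfl
    rw [h1, Substructure.closure_image, hx', ← Hom.range_eq_map]
    exact τ.toHom_range

/-- Up to isomorphism `K` is countable, `A` has countably many finitely generated substructures, and
a finitely generated structure has countably many embeddings into a countable one. Passing to
isomorphism classes of extensions ensures that each is listed once. -/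
theorem exists_isOnePointEnumeration [Countable (Σ l, L.Functions l)]
    {K : Set (Bundled.{w} L.Structure)} (hK : IsFraisse K)
    {A : Bundled.{w} L.Structure} (hA : A ∈ closureClass K) :
    ∃ R : RootedMultiAmalgam K A, IsOnePointEnumeration R := by
  have := hA.2.1
  let I : Type _ := ↥((Quotient.mk' : Bundled.{w} L.Structure → _) '' K)
  have : Countable I := hK.is_essentially_countable.to_subtype
  have hout : ∀ c : I, c.1.out ∈ K := by
    rintro ⟨_, E, hE, rfl⟩
    obtain ⟨τ⟩ : (Quotient.mk' E).out ≈ E := Quotient.mk_out E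
    exact mem_of_equiv hK τ.symm hE
  have : ∀ c : I, Countable c.1.out := fun c => countable_of_mem hK (hout c)
  let J : Type _ := {S : {S : L.Substructure A // S.FG} // Nonempty S.1}
  let X : Type _ := Σ (S : J) (c : I), {e : S.1.1 ↪[L] c.1.out // IsOnePointExt e}
  have : ∀ (S : J) (c : I), Countable (S.1.1 ↪[L] c.1.out) := fun S c =>
    Structure.FG.countable_embedding _ ((Substructure.fg_iff_structure_fg _).1 S.1.2)
  have : Countable X := inferInstance
  let r : Setoid X :=
    { r := fun x y => ExtIso x.2.2.1 y.2.2.1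
      iseqv := ⟨fun _ => ExtIso.refl _, ExtIso.symm, ExtIso.trans⟩ }
  -- Being countable, the set of classes has a copy in `Type`, where the index type of a
  -- `RootedMultiAmalgam` must live.
  let ε := equivShrink.{0} (Quotient r)
  let rep : Shrink.{0} (Quotient r) → X := fun i => (ε.symm i).out
  refine ⟨{ ι := Shrink.{0} (Quotient r)
            countable_ι := ε.symm.injective.countable
            B := fun i => (rep i).1.1.1
            C := fun i => (rep i).2.1.1.out
            emb := fun i => (rep i).2.2.1
            B_nonempty := fun i => (rep i).1.2
            B_fg := fun i => (rep i).1.1.2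
            B_mem := fun i => hA.2.2 _ (rep i).1.1.2
            C_mem := fun i => hout _ }, fun i => (rep i).2.2.2, ?_⟩
  intro S hne hfg E hE e he
  obtain ⟨τ⟩ : (Quotient.mk' E).out ≈ E := Quotient.mk_out E
  let x : X := ⟨⟨⟨S, hfg⟩, hne⟩, ⟨Quotient.mk' E, E, hE, rfl⟩, τ.symm.toEmbedding.comp e,
    he.comp_equiv τ.symm⟩
  have hx : ExtIso x.2.2.1 e := ⟨rfl, τ, fun b => τ.apply_symm_apply (e b)⟩
  refine ⟨ε (Quotient.mk r x), ?_, ?_⟩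
  · have h1 : ExtIso (rep (ε (Quotient.mk r x))).2.2.1 x.2.2.1 := by
      have : rep (ε (Quotient.mk r x)) = (Quotient.mk r x).out := by
        simp only [rep, Equiv.symm_apply_apply]
      rw [this]
      exact Quotient.mk_out (s := r) x
    exact h1.trans hx
  · intro j hj
    have h1 : ExtIso (rep j).2.2.1 x.2.2.1 := ExtIso.trans hj hx.symm
    have h2 : Quotient.mk r (rep j) = Quotient.mk r x := Quotient.sound h1
    rw [← h2, Quotient.out_eq, Equiv.apply_symm_apply]

theorem exists_isStar [Countable (Σ l, L.Functions l)]
    {K : Set (Bundled.{w} L.Structure)} (hK : IsFraisse K) (h_ap : StrictAP K)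
    {A : Bundled.{w} L.Structure} (hA : A ∈ closureClass K) : ∃ D, IsStar K A D := by
  obtain ⟨R, hR⟩ := exists_isOnePointEnumeration hK hA
  obtain ⟨D, hD⟩ := exists_isFreeSum hK h_ap hA R
  exact ⟨D, R, hR, hD⟩

/-! ### Extensions by at most one point -/

/-- The extension `e` is trivial or a one-point extension. -/
def IsSmallExt {B C : Type w} [L.Structure B] [L.Structure C] (e : B ↪[L] C) : Prop :=
  Function.Surjective e ∨ IsOnePointExt e

/-- A surjective embedding is an isomorphism. -/
noncomputable def equivOfSurjective {B C : Type*} [L.Structure B] [L.Structure C] (e : B ↪[L] C)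
    (he : Function.Surjective e) : B ≃[L] C where
  toEquiv := Equiv.ofBijective e ⟨e.injective, he⟩
  map_fun' := e.map_fun
  map_rel' := e.map_rel

theorem IsPushoutSquare.comp_equiv {T : Set (Bundled.{w} L.Structure)}
    {X Y Z P Y' : Bundled.{w} L.Structure} {i : X →[L] Y} {p : X →[L] Z} {f' : Y →[L] P}
    {i' : Z →[L] P} (h : IsPushoutSquare T i p f' i') (hY' : Y' ∈ T) (σ : Y ≃[L] Y') :
    IsPushoutSquare T (σ.toHom.comp i) p (f'.comp σ.symm.toHom) i' where
  mem_X := h.mem_X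
  mem_Y := hY'
  mem_Z := h.mem_Z
  mem_P := h.mem_P
  comm := by
    rw [← h.comm]
    ext x
    exact congrArg f' (σ.symm_apply_apply (i x))
  desc Q hQ j₁ j₂ hj := by
    obtain ⟨k, ⟨hk₁, hk₂⟩, hk⟩ := h.desc Q hQ (j₁.comp σ.toHom) j₂ hj
    refine ⟨k, ⟨?_, hk₂⟩, fun k' hk' => hk k' ⟨?_, hk'.2⟩⟩
    · ext y
      refine (DFunLike.congr_fun hk₁ (σ.symm y)).trans ?_
      exact congrArg j₁ (σ.apply_symm_apply y)
    · rw [← hk'.1]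
      ext y
      exact congrArg (fun z => k' (f' z)) (σ.symm_apply_apply y).symm

/-- Small extensions can be pushed forward along surjective homomorphisms. -/
theorem exists_pushout_of_isSmallExt [Countable (Σ l, L.Functions l)]
    {K : Set (Bundled.{w} L.Structure)} (hK : IsFraisse K) (h_hep : StrictOnePHEP K)
    {B B' C : Bundled.{w} L.Structure} (hB : B ∈ K) (hB' : B' ∈ K) (hC : C ∈ K)
    (hn : Nonempty B) {e : B ↪[L] C} (he : IsSmallExt e) {p : B →[L] B'}
    (hp : Function.Surjective p) :
    ∃ P ∈ K, ∃ (f' : C →[L] P) (i' : B' ↪[L] P),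
      IsPushoutSquare (closureClass K) e.toHom p f' i'.toHom ∧ IsSmallExt i' := by
  rcases he with he | he
  · have := hn.map e
    have := hn.map p
    exact ⟨B', hB', _, Embedding.refl L B', IsPushoutSquare.of_equiv (mem_closureClass_of_mem hK hB)
      (mem_closureClass_of_mem hK hC) (mem_closureClass_of_mem hK hB')
      (equivOfSurjective e he) p, Or.inl Function.surjective_id⟩
  · obtain ⟨⟨P, hP, f', i', h⟩, h2⟩ := h_hep B hB B' hB' C hC hn e p he hp
    obtain ⟨⟨i', rfl⟩, hf'⟩ := h2 P f' i' h
    refine ⟨P, hP, f', i', h, ?_⟩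
    obtain ⟨x, -, hx⟩ := he
    have hgen : Substructure.closure L (Set.range i' ∪ {f' x}) = ⊤ := by
      rw [eq_top_iff, ← Hom.range_eq_top.2 hf', Hom.range_eq_map, ← hx, Substructure.map_closure]
      refine Substructure.closure_mono ?_
      rintro _ ⟨y, ⟨b, rfl⟩ | rfl, rfl⟩
      · exact Or.inl ⟨p b, (DFunLike.congr_fun h.comm b).symm⟩
      · exact Or.inr rfl
    -- The pushout may identify the added point with an element of `B'`; this is why trivial
    -- extensions must be admitted.
    by_cases hxi : f' x ∈ Set.range i'
    · left
      rw [Set.union_eq_self_of_subset_right (Set.singleton_subset_iff.2 hxi)] at hgen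
      have h3 : Set.range i' = (i'.toHom.range : Set P) := rfl
      rw [h3, Substructure.closure_eq] at hgen
      exact Hom.range_eq_top.1 hgen
    · exact Or.inr ⟨f' x, hxi, hgen⟩

/-! ### Extending endomorphisms of `A` to `A⋆` -/

/-- The structure `D` together with the data that make it a copy of `A⋆`. -/
structure StarCocone (K : Set (Bundled.{w} L.Structure)) (A D : Bundled.{w} L.Structure) where
  R : RootedMultiAmalgam K A
  enum : IsOnePointEnumeration R
  mem : D ∈ closureClass K
  f : A ↪[L] D
  g : ∀ i, R.C i ↪[L] D
  comm : ∀ i (b : R.B i), f b = g i (R.emb i b)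
  desc : ∀ D' ∈ closureClass K, ∀ (φ : A →[L] D') (ψ : ∀ i, R.C i →[L] D'),
    (∀ i (b : R.B i), φ b = ψ i (R.emb i b)) →
      ∃! δ : D →[L] D', δ.comp f.toHom = φ ∧ ∀ i, δ.comp (g i).toHom = ψ i

theorem IsStar.nonempty_starCocone {K : Set (Bundled.{w} L.Structure)}
    {A D : Bundled.{w} L.Structure} (h : IsStar K A D) : Nonempty (StarCocone K A D) := by
  obtain ⟨R, hR, hD, f, g, hfg, hdesc⟩ := h
  exact ⟨⟨R, hR, hD, f, g, hfg, hdesc⟩⟩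

namespace StarCocone

variable {K : Set (Bundled.{w} L.Structure)} {A D : Bundled.{w} L.Structure}
  (c : StarCocone K A D)

/-- The map `h` is the standard map into `A⋆` of the extension `e` of a substructure of `A`: it
extends the inclusion and, unless `e` is trivial, comes from the enumeration. -/
def IsStd {S : L.Substructure A} {E : Bundled.{w} L.Structure} (e : S ↪[L] E) (h : E →[L] D) :
    Prop :=
  (∀ b, h (e b) = c.f b) ∧ (Function.Surjective e ∨
    ∃ (i : c.R.ι) (hB : c.R.B i = S) (σ : c.R.C i ≃[L] E),
      (∀ b, σ (c.R.emb i b) = e (Substructure.inclusion hB.le b)) ∧ ∀ x, h (σ x) = c.g i x)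

theorem exists_isStd {S : L.Substructure A} (hn : Nonempty S) (hS : S.FG)
    {E : Bundled.{w} L.Structure} (hE : E ∈ K) {e : S ↪[L] E} (he : IsSmallExt e) :
    ∃ h : E ↪[L] D, c.IsStd e h.toHom := by
  rcases he with he | he
  · refine ⟨(c.f.comp S.subtype).comp (equivOfSurjective e he).symm.toEmbedding, fun b => ?_,
      Or.inl he⟩
    exact congrArg (fun s : S => c.f s) ((equivOfSurjective e he).symm_apply_apply b)
  · obtain ⟨i, ⟨hB, σ, hσ⟩, -⟩ := c.enum.existsUnique S hn hS E hE e he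
    refine ⟨(c.g i).comp σ.symm.toEmbedding, fun b => ?_, Or.inr ⟨i, hB, σ, hσ, fun x => ?_⟩⟩
    · subst hB
      have h1 : e b = σ (c.R.emb i b) := (hσ b).symm
      rw [h1]
      exact (congrArg (c.g i) (σ.symm_apply_apply _)).trans (c.comm i b).symm
    · exact congrArg (c.g i) (σ.symm_apply_apply _)

variable {c}

/-- A map from a trivial extension is determined on the base. Otherwise both maps come from the same
index `i`, and the two identifications of `C i` with `E` differ by an automorphism of `C i` fixing
`B i`, which is trivial. -/
theorem IsStd.unique (h_stab : TrivialStabilizers K) {S : L.Substructure A} (hn : Nonempty S)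
    (hS : S.FG) {E : Bundled.{w} L.Structure} (hE : E ∈ K) {e : S ↪[L] E} (he : IsSmallExt e)
    {h h' : E →[L] D} (hh : c.IsStd e h) (hh' : c.IsStd e h') : h = h' := by
  by_cases hes : Function.Surjective e
  · ext x
    obtain ⟨b, rfl⟩ := hes x
    rw [hh.1, hh'.1]
  · obtain ⟨i, hB, σ, hσ, hg⟩ := hh.2.resolve_left hes
    obtain ⟨j, hB', τ, hτ, hg'⟩ := hh'.2.resolve_left hes
    obtain rfl : i = j := (c.enum.existsUnique S hn hS E hE e (he.resolve_left hes)).unique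
      ⟨hB, σ, hσ⟩ ⟨hB', τ, hτ⟩
    have key : τ.symm.comp σ = Language.Equiv.refl L (c.R.C i) := by
      refine h_stab ⟨c.R.B i, inferInstance⟩ (c.R.B_mem i) (c.R.C i) (c.R.C_mem i)
        (c.R.B_nonempty i) (c.R.emb i) (c.enum.onePoint i) _ fun b => ?_
      refine (congrArg τ.symm ((hσ b).trans (hτ b).symm)).trans (τ.symm_apply_apply _)
    ext x
    obtain ⟨y, rfl⟩ := σ.surjective x
    have h1 : τ.symm (σ y) = y := DFunLike.congr_fun key y
    have h2 : σ y = τ y := by rw [← τ.apply_symm_apply (σ y), h1]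
    rw [hg, h2, hg']

theorem IsStd.comp_equiv {S : L.Substructure A} {E E' : Bundled.{w} L.Structure} {e : S ↪[L] E}
    {h : E →[L] D} (hh : c.IsStd e h) (σ : E' ≃[L] E) {e' : S ↪[L] E'} (he : ∀ b, σ (e' b) = e b) :
    c.IsStd e' (h.comp σ.toHom) := by
  refine ⟨fun b => (congrArg h (he b)).trans (hh.1 b), ?_⟩
  rcases hh.2 with hs | ⟨i, hB, τ, hτ, hg⟩
  · left
    intro x
    obtain ⟨b, hb⟩ := hs (σ x)
    exact ⟨b, σ.injective ((he b).trans hb)⟩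
  · refine Or.inr ⟨i, hB, σ.symm.comp τ, fun b => ?_, fun x => ?_⟩
    · refine (congrArg σ.symm ((hτ b).trans (he _).symm)).trans (σ.symm_apply_apply _)
    · exact (congrArg h (σ.apply_symm_apply (τ x))).trans (hg x)

theorem isStd_emb (c : StarCocone K A D) (i : c.R.ι) : c.IsStd (c.R.emb i) (c.g i).toHom :=
  ⟨fun b => (c.comm i b).symm,
    Or.inr ⟨i, rfl, Language.Equiv.refl L _, fun _ => rfl, fun _ => rfl⟩⟩

/-- The map `k` is the canonical map from the pushout of `e` along `φ` to `A⋆`, preceded by the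
canonical map into that pushout. -/
def IsPush (c : StarCocone K A D) (φ : A →[L] A) {S : L.Substructure A}
    {E : Bundled.{w} L.Structure} (e : S ↪[L] E) (k : E →[L] D) : Prop :=
  ∃ (S' : L.Substructure A) (p : S →[L] S') (P : Bundled.{w} L.Structure) (f' : E →[L] P)
    (i' : S' ↪[L] P) (h : P →[L] D), (∀ b, (p b : A) = φ b) ∧ Function.Surjective p ∧ P ∈ K ∧
      IsSmallExt i' ∧ IsPushoutSquare (closureClass K) (X := ⟨S, inferInstance⟩)
        (Z := ⟨S', inferInstance⟩) e.toHom p f' i'.toHom ∧ c.IsStd i' h ∧ k = h.comp f'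

theorem exists_isPush [Countable (Σ l, L.Functions l)] (hK : IsFraisse K)
    (h_hep : StrictOnePHEP K) (hA : A ∈ closureClass K) (c : StarCocone K A D) (φ : A →[L] A)
    {S : L.Substructure A} (hn : Nonempty S) (hS : S.FG) {E : Bundled.{w} L.Structure}
    (hE : E ∈ K) {e : S ↪[L] E} (he : IsSmallExt e) : ∃ k, c.IsPush φ e k := by
  let S' := S.map φ
  let p : S →[L] S' := (φ.domRestrict S).codRestrict S' fun b => ⟨b, b.2, rfl⟩
  have hp : Function.Surjective p := by
    rintro ⟨_, b, hb, rfl⟩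
    exact ⟨⟨b, hb⟩, rfl⟩
  obtain ⟨P, hP, f', i', h, hi'⟩ := exists_pushout_of_isSmallExt hK h_hep
    (B := ⟨S, inferInstance⟩) (B' := ⟨S', inferInstance⟩) (hA.2.2 S hS) (hA.2.2 S' (hS.map φ))
    hE hn he hp
  obtain ⟨k, hk⟩ := c.exists_isStd (hn.map p) (hS.map φ) hP hi'
  exact ⟨_, S', p, P, f', i', k.toHom, fun _ => rfl, hp, hP, hi', h, hk, rfl⟩

theorem IsPush.apply {φ : A →[L] A} {S : L.Substructure A} {E : Bundled.{w} L.Structure}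
    {e : S ↪[L] E} {k : E →[L] D} (hk : c.IsPush φ e k) (b : S) : k (e b) = c.f (φ b) := by
  obtain ⟨S', p, P, f', i', h, hp, -, -, -, hsq, hh, rfl⟩ := hk
  rw [← hp, ← hh.1]
  exact congrArg h (DFunLike.congr_fun hsq.comm b)

/-- The base `S'` must be the image of `S` under `φ`, the pushout is unique up to a compatible
isomorphism, and the standard map out of it is unique. -/
theorem IsPush.unique (h_stab : TrivialStabilizers K) {φ : A →[L] A} {S : L.Substructure A}
    (hn : Nonempty S) (hS : S.FG) {E : Bundled.{w} L.Structure} {e : S ↪[L] E} {k₁ k₂ : E →[L] D}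
    (hk₁ : c.IsPush φ e k₁) (hk₂ : c.IsPush φ e k₂) : k₁ = k₂ := by
  obtain ⟨S₁, p₁, P₁, f₁, i₁, h₁, hp₁, hps₁, hP₁, hi₁, hsq₁, hh₁, rfl⟩ := hk₁
  obtain ⟨S₂, p₂, P₂, f₂, i₂, h₂, hp₂, hps₂, hP₂, hi₂, hsq₂, hh₂, rfl⟩ := hk₂
  have hmap : ∀ (T : L.Substructure A) (p : S →[L] T), (∀ b, (p b : A) = φ b) →
      Function.Surjective p → T = S.map φ := by
    intro T p hp hps
    ext x
    constructor
    · intro hx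
      obtain ⟨b, hb⟩ := hps ⟨x, hx⟩
      exact ⟨b, b.2, (hp b).symm.trans (congrArg Subtype.val hb)⟩
    · rintro ⟨b, hb, rfl⟩
      have := (p ⟨b, hb⟩).2
      rwa [hp] at this
  obtain rfl := hmap S₁ p₁ hp₁ hps₁
  obtain rfl := hmap S₂ p₂ hp₂ hps₂
  obtain rfl : p₁ = p₂ := Hom.ext fun b => Subtype.ext ((hp₁ b).trans (hp₂ b).symm)
  obtain ⟨τ, hτf, hτi⟩ := hsq₁.exists_equiv hsq₂
  have := hh₁.unique h_stab (hn.map p₁) (hS.map φ) hP₁ hi₁ (hh₂.comp_equiv τ hτi)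
  rw [this]
  exact Hom.ext fun x => congrArg h₂ (hτf x)

/-- The endomorphism `δ` of `A⋆` is the canonical extension of the endomorphism `φ` of `A`. -/
def IsExtension (c : StarCocone K A D) (φ : A →[L] A) (δ : D →[L] D) : Prop :=
  (∀ a, δ (c.f a) = c.f (φ a)) ∧ ∀ i, c.IsPush φ (c.R.emb i) (δ.comp (c.g i).toHom)

theorem isSmallExt_emb (c : StarCocone K A D) (i : c.R.ι) : IsSmallExt (c.R.emb i) :=
  Or.inr (c.enum.onePoint i)

theorem exists_isExtension [Countable (Σ l, L.Functions l)] (hK : IsFraisse K)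
    (h_hep : StrictOnePHEP K) (hA : A ∈ closureClass K) (c : StarCocone K A D) (φ : A →[L] A) :
    ∃ δ, c.IsExtension φ δ := by
  choose k hk using fun i => exists_isPush hK h_hep hA c φ (c.R.B_nonempty i) (c.R.B_fg i)
    (c.R.C_mem i) (c.isSmallExt_emb i)
  obtain ⟨δ, ⟨h₁, h₂⟩, -⟩ := c.desc D c.mem (c.f.toHom.comp φ) k
    (fun i b => ((hk i).apply b).symm)
  exact ⟨δ, DFunLike.congr_fun h₁, fun i => by rw [h₂ i]; exact hk i⟩

theorem IsExtension.unique (h_stab : TrivialStabilizers K) {φ : A →[L] A} {δ δ' : D →[L] D}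
    (h : c.IsExtension φ δ) (h' : c.IsExtension φ δ') : δ = δ' := by
  refine (c.desc D c.mem (c.f.toHom.comp φ) (fun i => δ.comp (c.g i).toHom)
    (fun i b => ((h.2 i).apply b).symm)).unique ⟨Hom.ext h.1, fun _ => rfl⟩
    ⟨Hom.ext h'.1, fun i => ?_⟩
  exact (h'.2 i).unique h_stab (c.R.B_nonempty i) (c.R.B_fg i) (h.2 i)

/-- The canonical extension of an endomorphism is compatible with all standard maps. -/
theorem IsExtension.isPush_comp [Countable (Σ l, L.Functions l)] (hK : IsFraisse K)
    (h_hep : StrictOnePHEP K) (hA : A ∈ closureClass K)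
    {φ : A →[L] A} {δ : D →[L] D} (hδ : c.IsExtension φ δ)
    {S : L.Substructure A} (hn : Nonempty S) (hS : S.FG) {E : Bundled.{w} L.Structure}
    (hE : E ∈ K) {e : S ↪[L] E} (he : IsSmallExt e) {h : E →[L] D} (hh : c.IsStd e h) :
    c.IsPush φ e (δ.comp h) := by
  by_cases hes : Function.Surjective e
  · obtain ⟨k, hk⟩ := exists_isPush hK h_hep hA c φ hn hS hE he
    have : k = δ.comp h := by
      ext x
      obtain ⟨b, rfl⟩ := hes x
      rw [hk.apply, ← hδ.1, ← hh.1]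
      rfl
    rwa [← this]
  -- Here `h` is the listed map `c.g i` up to the isomorphism `σ`, so the pushout square known for
  -- `i` is transported along `σ`.
  · obtain ⟨i, rfl, σ, hσ, hg⟩ := hh.2.resolve_left hes
    obtain ⟨S', p, P, f', i', k, hp, hps, hP, hi', hsq, hk, hkf⟩ := hδ.2 i
    have : Nonempty E := hn.map e
    have h1 : σ.toHom.comp (c.R.emb i).toHom = e.toHom := Hom.ext hσ
    refine ⟨S', p, P, f'.comp σ.symm.toHom, i', k, hp, hps, hP, hi', ?_, hk, ?_⟩
    · rw [← h1]
      exact hsq.comp_equiv (mem_closureClass_of_mem hK hE) σ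
    · ext x
      obtain ⟨y, rfl⟩ := σ.surjective x
      refine (congrArg δ (hg y)).trans ((DFunLike.congr_fun hkf y).trans ?_)
      exact congrArg (fun z => k (f' z)) (σ.symm_apply_apply y).symm

/-- On `C i`, the map `ε` passes through a pushout `P` followed by a standard map, and `isPush_comp`
describes `δ` on that standard map. Pasting the two squares gives the pushout along `φ.comp ψ`. -/
theorem IsExtension.comp [Countable (Σ l, L.Functions l)] (hK : IsFraisse K)
    (h_hep : StrictOnePHEP K) (hA : A ∈ closureClass K)
    {φ ψ : A →[L] A} {δ ε : D →[L] D} (hδ : c.IsExtension φ δ) (hε : c.IsExtension ψ ε) :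
    c.IsExtension (φ.comp ψ) (δ.comp ε) := by
  refine ⟨fun a => (congrArg δ (hε.1 a)).trans (hδ.1 _), fun i => ?_⟩
  obtain ⟨S', p, P, f', i', h', hp, hps, hP, hi', hsq, hh', hk'⟩ := hε.2 i
  have hS' : S'.FG := (Substructure.fg_iff_structure_fg _).2
    (((Substructure.fg_iff_structure_fg _).1 (c.R.B_fg i)).map_of_surjective p hps)
  obtain ⟨S'', q, Q, f'', i'', h'', hq, hqs, hQ, hi'', hsq', hh'', hk''⟩ :=
    hδ.isPush_comp hK h_hep hA ((c.R.B_nonempty i).map p) hS' hP hi' hh'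
  refine ⟨S'', q.comp p, Q, f''.comp f', i'', h'', fun b => ?_, hqs.comp hps, hQ, hi'',
    hsq.paste hsq', hh'', ?_⟩
  · exact (hq (p b)).trans (congrArg φ (hp b))
  · rw [Hom.comp_assoc, hk', ← Hom.comp_assoc, hk'', Hom.comp_assoc]

theorem isExtension_id [Countable (Σ l, L.Functions l)] (hK : IsFraisse K)
    (c : StarCocone K A D) :
    c.IsExtension (Hom.id L A) (Hom.id L D) := by
  refine ⟨fun _ => rfl, fun i => ?_⟩
  have := c.R.B_nonempty i
  have : Nonempty (c.R.C i) := (c.R.B_nonempty i).map (c.R.emb i)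
  exact ⟨c.R.B i, Hom.id L _, c.R.C i, Hom.id L _, c.R.emb i, (c.g i).toHom, fun _ => rfl,
    Function.surjective_id, c.R.C_mem i, c.isSmallExt_emb i,
    IsPushoutSquare.of_id (X := ⟨c.R.B i, inferInstance⟩)
      (mem_closureClass_of_mem hK (c.R.B_mem i)) (mem_closureClass_of_mem hK (c.R.C_mem i)) _,
    c.isStd_emb i, rfl⟩

/-- Canonical extension of endomorphisms is a monoid homomorphism. -/
theorem exists_endHom [Countable (Σ l, L.Functions l)] (hK : IsFraisse K)
    (h_hep : StrictOnePHEP K) (h_stab : TrivialStabilizers K) (hA : A ∈ closureClass K)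
    (c : StarCocone K A D) :
    ∃ Φ : (A →[L] A) →* (D →[L] D), ∀ φ a, Φ φ (c.f a) = c.f (φ a) := by
  choose Φ hΦ using exists_isExtension hK h_hep hA c
  exact ⟨{ toFun := Φ
           map_one' := (hΦ _).unique h_stab (isExtension_id hK c)
           map_mul' := fun φ ψ => (hΦ _).unique h_stab ((hΦ φ).comp hK h_hep hA (hΦ ψ)) },
    fun φ => (hΦ φ).1⟩

end StarCocone

/-- `φ` is recovered from `Φ φ` by restriction to the copy of `A`. -/
theorem endEmbeds_of_intertwine {A D : Type w} [L.Structure A] [L.Structure D] (f : A ↪[L] D)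
    (Φ : (A →[L] A) →* (D →[L] D)) (h : ∀ φ a, Φ φ (f a) = f (φ a)) : EndEmbeds L A D := by
  refine ⟨Φ, fun φ ψ hφψ => Hom.ext fun a => f.injective ?_⟩
  rw [← h, ← h, hφψ]

/-! ### Structures realizing all one-point extensions -/

theorem IsOnePointExt.equiv_comp {B B' C : Type w} [L.Structure B] [L.Structure B']
    [L.Structure C] {e : B ↪[L] C} (h : IsOnePointExt e) (σ : B' ≃[L] B) :
    IsOnePointExt (e.comp σ.toEmbedding) := by
  have : Set.range (e.comp σ.toEmbedding) = Set.range e := σ.surjective.range_comp e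
  unfold IsOnePointExt
  rwa [this]

/-- Every one-point extension in `K` of a finitely generated substructure of `M` embeds into `M`
over that substructure. -/
def RealizesOnePointExts (K : Set (Bundled.{w} L.Structure)) (M : Type w) [L.Structure M] : Prop :=
  ∀ S : L.Substructure M, S.FG → Nonempty S → ∀ E ∈ K, ∀ e : S ↪[L] E, IsOnePointExt e →
    ∃ h : E ↪[L] M, ∀ b, h (e b) = b

theorem isOnePointExt_inclusion {M : Type w} [L.Structure M] (T : L.Substructure M) {a : M}
    (ha : a ∉ T) :
    IsOnePointExt (Substructure.inclusion (le_sup_left : T ≤ T ⊔ Substructure.closure L {a})) := by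
  have haT : a ∈ T ⊔ Substructure.closure L {a} :=
    (le_sup_right : _ ≤ T ⊔ Substructure.closure L {a}) (Substructure.subset_closure rfl)
  refine ⟨⟨a, haT⟩, ?_, ?_⟩
  · rintro ⟨b, hb⟩
    have hba : (b : M) = a := congrArg Subtype.val hb
    exact ha (hba ▸ b.2)
  -- Generation is checked after mapping into `M`, where the closure is computed as a join.
  · apply Substructure.map_injective_of_injective (Substructure.subtype_injective _)
      (f := (Substructure.subtype _).toHom)
    have h1 : (Substructure.subtype (T ⊔ Substructure.closure L {a})).toHom ''
        (Set.range (Substructure.inclusion le_sup_left) ∪ {⟨a, haT⟩}) = (T : Set M) ∪ {a} := by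
      rw [Set.image_union, Set.image_singleton, ← Set.range_comp]
      exact congrArg (· ∪ {a}) (Subtype.range_coe (s := (T : Set M)))
    rw [Substructure.map_closure, h1, ← Hom.range_eq_map, Substructure.range_subtype,
      Substructure.closure_union, Substructure.closure_eq]

/-- `C` is reached from the image of `B` by adding finitely many generators, each giving a trivial
or a one-point extension. -/
theorem RealizesOnePointExts.exists_extend {K : Set (Bundled.{w} L.Structure)} (hK : IsFraisse K)
    {M : Type w} [L.Structure M] (hM : RealizesOnePointExts K M) {B C : Bundled.{w} L.Structure}
    (hB : Structure.FG L B) (hn : Nonempty B) (hC : C ∈ K) (e : B ↪[L] C) (k : B ↪[L] M) :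
    ∃ h : C ↪[L] M, ∀ b, h (e b) = k b := by
  let Good : L.Substructure C → Prop := fun T =>
    T.FG ∧ e.toHom.range ≤ T ∧ ∃ h : T ↪[L] M, ∀ b (hb : e b ∈ T), h ⟨e b, hb⟩ = k b
  have base : Good e.toHom.range := by
    refine ⟨hB.range _, le_rfl, k.comp e.equivRange.symm.toEmbedding, fun b hb => ?_⟩
    exact congrArg k (e.equivRange.symm_apply_apply b)
  have step : ∀ T a, Good T → Good (T ⊔ Substructure.closure L {a}) := by
    rintro T a ⟨hT, hle, h, hh⟩
    by_cases ha : a ∈ T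
    · rw [sup_eq_left.2 (Substructure.closure_le.2 (Set.singleton_subset_iff.2 ha))]
      exact ⟨hT, hle, h, hh⟩
    · have hT' := hT.sup (Substructure.fg_closure_singleton a)
      -- Through `h` the enlarged substructure becomes a one-point extension of the image of `T` in
      -- `M`, to which the hypothesis on `M` applies.
      obtain ⟨h', hh'⟩ := hM h.toHom.range
        (((Substructure.fg_iff_structure_fg _).1 hT).range h.toHom)
        (hn.map fun b => h.equivRange ⟨e b, hle ⟨b, rfl⟩⟩)
        ⟨_, inferInstance⟩ (hK.hereditary C hC
          ⟨(Substructure.fg_iff_structure_fg _).1 hT', ⟨Substructure.subtype _⟩⟩) _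
        ((isOnePointExt_inclusion T ha).equiv_comp h.equivRange.symm)
      refine ⟨hT', hle.trans le_sup_left, h', fun b hb => ?_⟩
      have hbT : e b ∈ T := hle ⟨b, rfl⟩
      rw [← hh b hbT]
      refine Eq.trans ?_ (hh' (h.equivRange ⟨e b, hbT⟩))
      exact congrArg (fun t : T => h' (Substructure.inclusion le_sup_left t))
        (h.equivRange.symm_apply_apply ⟨e b, hbT⟩).symm
  have all : ∀ s : Set C, s.Finite → Good (e.toHom.range ⊔ Substructure.closure L s) := by
    intro s hs
    induction s, hs using Set.Finite.induction_on with
    | empty => rwa [Substructure.closure_empty, sup_bot_eq]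
    | insert _ _ ih =>
      rw [Set.insert_eq, Set.union_comm, Substructure.closure_union, ← sup_assoc]
      exact step _ _ ih
  obtain ⟨s, hs, hs'⟩ := Structure.fg_iff.1 (hK.FG C hC)
  obtain ⟨-, -, h, hh⟩ := all s hs
  have htop : ∀ x : C, x ∈ e.toHom.range ⊔ Substructure.closure L s := by
    intro x
    rw [hs', sup_top_eq]
    trivial
  exact ⟨h.comp ((Embedding.refl L C).codRestrict _ htop), fun b => hh b _⟩

/-- Extending embeddings along finitely generated extensions gives ultrahomogeneity. For the age,
embed a member of `K` jointly with a one-generated substructure of `M` and extend the inclusion of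
the latter. -/
theorem RealizesOnePointExts.isFraisseLimit [Countable (Σ l, L.Functions l)]
    {K : Set (Bundled.{w} L.Structure)} (hK : IsFraisse K) {M : Bundled.{w} L.Structure}
    [Countable M] (hMK : M ∈ closureClass K) (hM : RealizesOnePointExts K M) :
    IsFraisseLimit K M := by
  constructor
  · rw [isUltrahomogeneous_iff_IsExtensionPair Structure.cg_of_countable]
    rintro ⟨f, hf⟩ m
    let T := f.dom ⊔ Substructure.closure L {m}
    have hT : T.FG := hf.sup (Substructure.fg_closure_singleton m)
    obtain ⟨g, hg⟩ : ∃ g : T ↪[L] M,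
        ∀ b, g (Substructure.inclusion (le_sup_left : f.dom ≤ T) b) = f.toEquiv b := by
      by_cases hn : Nonempty f.dom
      · exact hM.exists_extend hK (B := ⟨f.dom, inferInstance⟩) (C := ⟨T, inferInstance⟩)
          ((Substructure.fg_iff_structure_fg _).1 hf) hn (hMK.2.2 T hT)
          (Substructure.inclusion le_sup_left) f.toEmbedding
      -- A partial isomorphism with empty domain imposes no condition, so the inclusion of `T`
      -- serves.
      · exact ⟨T.subtype, fun b => (hn ⟨b⟩).elim⟩
    refine ⟨⟨⟨T, g.toHom.range, g.equivRange⟩, hT⟩,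
      (le_sup_right : _ ≤ T) (Substructure.subset_closure rfl), le_sup_left, ?_⟩
    ext b
    exact hg b
  · apply Set.Subset.antisymm
    · rintro N ⟨hN, ⟨e⟩⟩
      exact mem_of_fg_of_embedding hK hMK hN e
    · intro E hE
      obtain ⟨a⟩ := hMK.1
      have hS := Substructure.fg_closure_singleton (L := L) a
      obtain ⟨P, hP, ⟨i⟩, ⟨j⟩⟩ := hK.jointEmbedding E hE _ (hMK.2.2 _ hS)
      obtain ⟨h, -⟩ := hM.exists_extend hK
        (B := ⟨Substructure.closure L {a}, inferInstance⟩)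
        ((Substructure.fg_iff_structure_fg _).1 hS)
        ⟨⟨a, Substructure.subset_closure rfl⟩⟩ hP j (Substructure.subtype _)
      exact ⟨hK.FG E hE, ⟨h.comp i⟩⟩

/-! ### Iterating the construction -/

theorem StarCocone.exists_embedding {K : Set (Bundled.{w} L.Structure)}
    {A D : Bundled.{w} L.Structure} (c : StarCocone K A D) {S : L.Substructure A} (hS : S.FG)
    (hn : Nonempty S) {E : Bundled.{w} L.Structure} (hE : E ∈ K) {e : S ↪[L] E}
    (he : IsOnePointExt e) : ∃ h : E ↪[L] D, ∀ b, h (e b) = c.f b :=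
  let ⟨h, hh⟩ := c.exists_isStd hn hS hE (Or.inr he)
  ⟨h, hh.1⟩

/-- Compatible homomorphisms between endomorphism monoids along a chain yield one into the
endomorphism monoid of the union. -/
theorem IsChainLimit.exists_endHom {G : ℕ → Type w} [∀ n, L.Structure (G n)]
    {u : ∀ n, G n ↪[L] G (n + 1)} {D : Type w} [L.Structure D] {ι : ∀ n, G n ↪[L] D}
    (h : IsChainLimit u ι) (Φ : ∀ n, (G n →[L] G n) →* (G (n + 1) →[L] G (n + 1)))
    (hΦ : ∀ n φ x, Φ n φ (u n x) = u n (φ x)) :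
    ∃ Ψ : (G 0 →[L] G 0) →* (D →[L] D), ∀ φ x, Ψ φ (ι 0 x) = ι 0 (φ x) := by
  let Θ : ∀ n, (G 0 →[L] G 0) →* (G n →[L] G n) := fun n =>
    Nat.rec (motive := fun n => (G 0 →[L] G 0) →* (G n →[L] G n)) (MonoidHom.id _)
      (fun n θ => (Φ n).comp θ) n
  have ex : ∀ φ, ∃ k : D →[L] D, ∀ n x, k (ι n x) = ι n (Θ n φ x) := fun φ =>
    h.exists_lift (fun n => (ι n).toHom.comp (Θ n φ)) fun n x =>
      (congrArg (ι (n + 1)) (hΦ n (Θ n φ) x)).trans (h.map_succ n _)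
  choose Ψ hΨ using ex
  refine ⟨{ toFun := Ψ, map_one' := ?_, map_mul' := fun φ ψ => ?_ }, fun φ => hΨ φ 0⟩
  · refine h.hom_ext fun n x => ?_
    rw [hΨ, map_one]
    rfl
  · refine h.hom_ext fun n x => ?_
    rw [hΨ, map_mul]
    refine Eq.trans ?_ (congrArg (Ψ φ) (hΨ ψ n x)).symm
    exact (hΨ φ n _).symm

/-- A finitely generated substructure lives at some stage `n`, and its extensions are realized at
stage `n + 1`. -/
theorem IsChainLimit.realizesOnePointExts {K : Set (Bundled.{w} L.Structure)}
    {G : ℕ → Type w} [∀ n, L.Structure (G n)]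
    {u : ∀ n, G n ↪[L] G (n + 1)} {D : Type w} [L.Structure D] {ι : ∀ n, G n ↪[L] D}
    (h : IsChainLimit u ι)
    (hu : ∀ n (S : L.Substructure (G n)), S.FG → Nonempty S → ∀ E ∈ K, ∀ e : S ↪[L] E,
      IsOnePointExt e → ∃ h : E ↪[L] G (n + 1), ∀ b, h (e b) = u n b) :
    RealizesOnePointExts K D := by
  intro S hS hn E hE e he
  obtain ⟨n, T, hT, rfl⟩ := h.exists_map_eq_of_fg hS
  let σ := (ι n).substructureEquivMap T
  obtain ⟨k, hk⟩ := hu n T hT (hn.map σ.symm) E hE _ (he.equiv_comp σ)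
  refine ⟨(ι (n + 1)).comp k, fun b => ?_⟩
  obtain ⟨t, rfl⟩ := σ.surjective b
  exact (congrArg (ι (n + 1)) (hk t)).trans (h.map_succ n _)

/-- Transport of endomorphisms along an isomorphism. -/
def endTransport {M N : Type w} [L.Structure M] [L.Structure N] (τ : M ≃[L] N) :
    (M →[L] M) →* (N →[L] N) where
  toFun φ := τ.toHom.comp (φ.comp τ.symm.toHom)
  map_one' := Hom.ext fun x => τ.apply_symm_apply x
  map_mul' φ ψ := Hom.ext fun x =>
    congrArg (fun y => τ (φ y)) (τ.symm_apply_apply (ψ (τ.symm x))).symm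

/-- The union of the iterated `⋆`-construction is a Fraïssé limit, so it is isomorphic to `F`, and
the endomorphisms induced by those of `A` are transported along this isomorphism. -/
theorem endEmbeds_of_isFraisseLimit [Countable (Σ l, L.Functions l)]
    {K : Set (Bundled.{w} L.Structure)} (hK : IsFraisse K) (h_ap : StrictAP K)
    (h_hep : StrictOnePHEP K) (h_stab : TrivialStabilizers K) {A : Bundled.{w} L.Structure}
    (hA : A ∈ closureClass K) {F : Type w} [L.Structure F] [Countable F]
    (hF : IsFraisseLimit K F) : EndEmbeds L A F := by
  have step : ∀ X : {X : Bundled.{w} L.Structure // X ∈ closureClass K},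
      ∃ Y : {X : Bundled.{w} L.Structure // X ∈ closureClass K}, Nonempty (StarCocone K X.1 Y.1) := by
    rintro ⟨X, hX⟩
    obtain ⟨Y, hY⟩ := exists_isStar hK h_ap hX
    obtain ⟨c⟩ := hY.nonempty_starCocone
    exact ⟨⟨Y, c.mem⟩, ⟨c⟩⟩
  choose next c using step
  let G : ℕ → {X : Bundled.{w} L.Structure // X ∈ closureClass K} := fun n =>
    Nat.rec (motive := fun _ => {X : Bundled.{w} L.Structure // X ∈ closureClass K}) ⟨A, hA⟩
      (fun _ X => next X) n
  let d : ∀ n, StarCocone K (G n).1 (G (n + 1)).1 := fun n => (c (G n)).some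
  obtain ⟨M, ι, hM⟩ := exists_isChainLimit (fun n => (G n).1) fun n => (d n).f
  have hMK : M ∈ closureClass K := hM.mem_closureClass hK fun n => (G n).2
  have : Countable M := hMK.2.1
  have hreal : RealizesOnePointExts K M := hM.realizesOnePointExts
    fun n S hS hn E hE e he => (d n).exists_embedding hS hn hE he
  obtain ⟨τ⟩ := (hreal.isFraisseLimit hK hMK).nonempty_equiv hF
  choose Φ hΦ using fun n => (d n).exists_endHom hK h_hep h_stab (G n).2
  obtain ⟨Ψ, hΨ⟩ := hM.exists_endHom Φ hΦ
  refine endEmbeds_of_intertwine (τ.toEmbedding.comp (ι 0)) ((endTransport τ).comp Ψ) fun φ a => ?_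
  refine (congrArg (fun y => τ (Ψ φ y)) (τ.symm_apply_apply (ι 0 a))).trans ?_
  exact congrArg τ (hΨ φ a)

end FraisseEnd

theorem theorem2p1 {L : FirstOrder.Language.{u, v}}
    [Countable (Σ l, L.Functions l)]
    (K : Set (CategoryTheory.Bundled.{w} L.Structure))
    (hK : FirstOrder.Language.IsFraisse K)
    (h_ap : FraisseEnd.StrictAP K)
    (h_hep : FraisseEnd.StrictOnePHEP K)
    (h_stab : FraisseEnd.TrivialStabilizers K)
    (A : CategoryTheory.Bundled.{w} L.Structure)
    (hA : A ∈ FraisseEnd.closureClass K) :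
    ((∃ D : CategoryTheory.Bundled.{w} L.Structure, FraisseEnd.IsStar K A D) ∧
      ∀ D : CategoryTheory.Bundled.{w} L.Structure, FraisseEnd.IsStar K A D →
        FraisseEnd.EndEmbeds L A D) ∧
    ∀ (F : Type w) [L.Structure F] [Countable F],
      FirstOrder.Language.IsFraisseLimit K F → FraisseEnd.EndEmbeds L A F := by
  refine ⟨⟨FraisseEnd.exists_isStar hK h_ap hA, fun D hD => ?_⟩, fun F _ _ hF =>
    FraisseEnd.endEmbeds_of_isFraisseLimit hK h_ap h_hep h_stab hA hF⟩
  obtain ⟨c⟩ := hD.nonempty_starCocone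
  obtain ⟨Φ, hΦ⟩ := c.exists_endHom hK h_hep h_stab hA
  exact FraisseEnd.endEmbeds_of_intertwine c.f Φ hΦ
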